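/- Let $k$ be a field of characteristic zero, let $\mathfrak g$ be a finite-dimensional split semisimple Lie algebra over $k$, and let $R$ be a commutative associative unital $k$-algebra such that $\operatorname{Spec} R$ is connected and reduced. Write $\mathfrak g(R)=\mathfrak g\otimes_k R$. An element $p\in\mathfrak g(R)$ is called $k$-diagonalizable if $\operatorname{ad}_{\mathfrak g(R)}p$, viewed as a $k$-linear endomorphism of $\mathfrak g(R)$, is diagonalizable. Let $\rho:\mathfrak g\to\mathfrak{gl}(V)$ be a finite-dimensional representation over $k$, and let $\rho_R:\mathfrak g(R)\to\mathfrak{gl}(V\otimes_k R)$ be the representation of the $R$-Lie algebra $\mathfrak g(R)$ obtained from it by extension of scalars. Let $p\in\mathfrak g(R)$ be $k$-diagonalizable. Then: (i) $\operatorname{Tr}\big(\rho_R(p)^m\big)\in k$ for all $m\in\mathbb N$, where $k$ is identified with its image in $R$ and the trace is that of an $R$-linear endomorphism of the free $R$-module of finite rank $V\otimes_k R$. (ii) If $p(y)=0$ for some $y\in\operatorname{Spec} R$, where $p(y)$ denotes the image of $p$ in $\mathfrak g\otimes_k k(y)$ and $k(y)$ is the residue field of $y$, then $p=0$. -/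

import Mathlib

open scoped TensorProduct

noncomputable section

/-- A finite-dimensional Lie algebra `L` over a field `k` is split if it has a splitting Cartan
subalgebra: a Cartan subalgebra `H` such that `ad h` is triangularizable over `k` for every
`h` in `H`. -/
def LieIsSplit (k : Type*) (L : Type*) [Field k] [LieRing L] [LieAlgebra k L] : Prop :=
  ∃ H : LieSubalgebra k L, H.IsCartanSubalgebra ∧ LieModule.IsTriangularizable k H L

/-- An element `p` of `L(R) = R ⊗[k] L` is `k`-diagonalizable if `ad p`, viewed as a `k`-linear
endomorphism of `L(R)`, is diagonalizable: its eigenspaces for eigenvalues in `k` span `L(R)`. -/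
def IsKDiagonalizable (k : Type*) {R L : Type*} [Field k] [CommRing R] [Algebra k R]
    [LieRing L] [LieAlgebra k L] (p : R ⊗[k] L) : Prop :=
  ⨆ μ : k, Module.End.eigenspace (LieAlgebra.ad k (R ⊗[k] L) p) μ = ⊤

/-- The evaluation `p ↦ p(y)` from `L(R)` to `L(k(y))` at a point `y` of `Spec R`, where `k(y)` is
the residue field of `y`: the map induced by the canonical homomorphism `R → k(y)`. -/
def evalAtPoint (k : Type*) {R L : Type*} [Field k] [CommRing R] [Algebra k R]
    [LieRing L] [LieAlgebra k L] (y : PrimeSpectrum R) :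
    R ⊗[k] L →ₗ⁅k⁆ y.asIdeal.ResidueField ⊗[k] L :=
  LieAlgebra.ExtendScalars.map (IsScalarTower.toAlgHom k R y.asIdeal.ResidueField) LieHom.id

/-- The `R`-linear endomorphism `ρ_R(p)` of `V(R) = R ⊗[k] V` by which `p` in `L(R)` acts, where
`V` is a representation `ρ` of `L` (a Lie module) and `ρ_R` is its extension of scalars:
`ρ_R (r ⊗ x) (s ⊗ v) = r * s ⊗ ρ x v`. -/
def baseChangeRep (k : Type*) {R L : Type*} (V : Type*) [Field k] [CommRing R] [Algebra k R]
    [LieRing L] [LieAlgebra k L] [AddCommGroup V] [Module k V] [LieRingModule L V]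
    [LieModule k L V] (p : R ⊗[k] L) : Module.End R (R ⊗[k] V) :=
  LieModule.toEnd R (R ⊗[k] L) (R ⊗[k] V) p

end

open scoped TensorProduct

/-! Connectedness of `Spec R` enters only through the absence of nontrivial idempotents. (i) Over an
algebraic closure of a residue field, let `l` be an eigenvalue of `p`. The generalized eigenspaces
for `l + k` span a submodule, as `ad p` has eigenvalues in `k`. By perfectness `p` has trace zero
there, so a nonzero multiple of `l` lies in `k`. Hence the traces take values in `k` at every prime,
and reducedness and connectedness make them constant. (ii) `ad p` is killed by `X * q` with `q(0) =
1`, so `q(ad p)` is a projection with kernel-valued image. Its determinant is idempotent and equals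
1 at `y`, hence is 1, so `ad p = 0`; `ad` is injective. -/

theorem IsIdempotentElem.eq_zero_or_eq_one_of_connectedSpace {R : Type*} [CommRing R]
    [ConnectedSpace (PrimeSpectrum R)] {e : R} (he : IsIdempotentElem e) : e = 0 ∨ e = 1 := by
  have h : IsClopen (PrimeSpectrum.basicOpen e : Set (PrimeSpectrum R)) :=
    PrimeSpectrum.isClopen_iff.2 ⟨e, he, rfl⟩
  rcases isClopen_iff.1 h with h | h
  · left
    have h' : PrimeSpectrum.basicOpen e = ⊥ := TopologicalSpace.Opens.ext h
    rw [PrimeSpectrum.basicOpen_eq_bot_iff] at h'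
    obtain ⟨n, hn⟩ := h'
    rcases n.eq_zero_or_pos with rfl | hn0
    · have := eq_zero_of_zero_eq_one (by simpa using hn.symm : (0 : R) = 1) e
      exact this
    · rwa [he.pow_eq hn0.ne'] at hn
  · right
    have h' : IsUnit e := by
      by_contra hu
      obtain ⟨P, hP, heP⟩ := exists_max_ideal_of_mem_nonunits hu
      exact (h.ge (Set.mem_univ (⟨P, hP.isPrime⟩ : PrimeSpectrum R))) heP
    exact (IsIdempotentElem.iff_eq_one_of_isUnit h').1 he

/-- Distinct constants differ by units. The product `w` of the factors other than `t - a`, divided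
by its value `d` at `t = a`, is idempotent: if it is 0, the root `a` can be dropped; if it is 1,
then `t = a`. -/
theorem mem_range_algebraMap_of_prod_sub_eq_zero {k R : Type*} [Field k] [CommRing R] [Algebra k R]
    [ConnectedSpace (PrimeSpectrum R)] (t : R) (s : Finset k)
    (h : ∏ c ∈ s, (t - algebraMap k R c) = 0) : t ∈ Set.range (algebraMap k R) := by
  classical
  have : Nontrivial R := PrimeSpectrum.nonempty_iff_nontrivial.1 inferInstance
  induction s using Finset.induction_on with
  | empty => simp at h
  | insert a s ha ih =>
    rw [Finset.prod_insert ha] at h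
    set w := ∏ c ∈ s, (t - algebraMap k R c) with hw
    let q : Polynomial R := ∏ c ∈ s, (Polynomial.X - Polynomial.C (algebraMap k R c))
    have hqt : q.eval t = w := by simp [q, hw, Polynomial.eval_prod]
    let d : k := ∏ c ∈ s, (a - c)
    have hd : d ≠ 0 := Finset.prod_ne_zero_iff.2 fun c hc => sub_ne_zero.2 (by rintro rfl; exact ha hc)
    have hqa : q.eval (algebraMap k R a) = algebraMap k R d := by
      simp [q, d, Polynomial.eval_prod, map_prod]
    obtain ⟨r, hr⟩ := q.sub_dvd_eval_sub t (algebraMap k R a)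
    rw [hqt, hqa] at hr
    have hu : algebraMap k R d * algebraMap k R d⁻¹ = 1 := by rw [← map_mul, mul_inv_cancel₀ hd, map_one]
    have he : IsIdempotentElem (w * algebraMap k R d⁻¹) := by
      have hww : w * w = algebraMap k R d * w := by
        linear_combination w * hr + r * h
      calc w * algebraMap k R d⁻¹ * (w * algebraMap k R d⁻¹)
          = (w * w) * (algebraMap k R d⁻¹ * algebraMap k R d⁻¹) := by ring
        _ = w * algebraMap k R d⁻¹ * (algebraMap k R d * algebraMap k R d⁻¹) := by rw [hww]; ring
        _ = _ := by rw [hu, mul_one]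
    rcases he.eq_zero_or_eq_one_of_connectedSpace with h0 | h1
    · refine ih ?_
      linear_combination (algebraMap k R d) * h0 - w * hu
    · refine ⟨a, (sub_eq_zero.1 ?_).symm⟩
      linear_combination (algebraMap k R d⁻¹) * h - (t - algebraMap k R a) * h1

/-- On a connected reduced affine `k`-scheme, a function all of whose values lie in `k` is a
constant in `k`. -/
theorem mem_range_algebraMap_of_forall_prime {k R : Type*} [Field k] [CommRing R] [Algebra k R]
    [ConnectedSpace (PrimeSpectrum R)] [IsReduced R] (t : R)
    (h : ∀ P : Ideal R, P.IsPrime → ∃ c : k, t - algebraMap k R c ∈ P) :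
    t ∈ Set.range (algebraMap k R) := by
  classical
  let S : Submonoid R := Submonoid.closure (Set.range fun c : k => t - algebraMap k R c)
  -- Otherwise some prime avoids every `t - c`, and `t` has no value in `k` there.
  have h0 : (0 : R) ∈ S := by
    by_contra h0
    obtain ⟨P, hP, -, hd⟩ := (⊥ : Ideal R).exists_le_prime_disjoint S (by
      rw [Set.disjoint_left]
      rintro x hx hxS
      obtain rfl : x = 0 := by simpa using hx
      exact h0 hxS)
    obtain ⟨c, hc⟩ := h P hP
    exact Set.disjoint_left.1 hd hc (Submonoid.subset_closure ⟨c, rfl⟩)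
  obtain ⟨l, hl, hl0⟩ := Submonoid.exists_multiset_of_mem_closure h0
  obtain ⟨m, rfl⟩ : ∃ m : Multiset k, m.map (fun c => t - algebraMap k R c) = l := by
    refine Multiset.induction_on l (fun _ => ⟨0, rfl⟩) (fun a l ih hl => ?_) hl
    obtain ⟨m, rfl⟩ := ih fun y hy => hl y (Multiset.mem_cons_of_mem hy)
    obtain ⟨c, rfl⟩ := hl a (Multiset.mem_cons_self _ _)
    exact ⟨c ::ₘ m, by simp⟩
  refine mem_range_algebraMap_of_prod_sub_eq_zero t m.toFinset ?_
  -- Removing repetitions leaves a nilpotent product, which is zero as `R` is reduced.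
  have hdvd : (m.map fun c => t - algebraMap k R c).prod ∣
      (∏ c ∈ m.toFinset, (t - algebraMap k R c)) ^ m.card := by
    rw [Finset.prod_multiset_map_count, ← Finset.prod_pow]
    exact Finset.prod_dvd_prod_of_dvd _ _ fun c _ => pow_dvd_pow _ (Multiset.count_le_card _ _)
  rw [hl0, zero_dvd_iff] at hdvd
  exact eq_zero_of_pow_eq_zero hdvd

theorem Matrix.eq_zero_of_aeval_X_mul_eq_zero {n R K : Type*} [Fintype n] [DecidableEq n]
    [CommRing R] [ConnectedSpace (PrimeSpectrum R)] [CommRing K] [Nontrivial K] (f : R →+* K)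
    (A : Matrix n n R) (hA : A.map f = 0) (q : Polynomial R) (hq : q.eval 0 = 1)
    (hAq : Polynomial.aeval A (Polynomial.X * q) = 0) : A = 0 := by
  have hq' : q = q.divX * Polynomial.X + 1 := by
    conv_lhs => rw [← q.divX_mul_X_add, Polynomial.coeff_zero_eq_eval_zero, hq, Polynomial.C_1]
  set r := Polynomial.aeval A q.divX
  set G := Polynomial.aeval A q with hG
  have hGr : G = r * A + 1 := by rw [hG, hq']; simp [r]
  have hAG : A * G = 0 := by simpa using hAq
  have hGG : G * G = G := by
    nth_rewrite 1 [hGr]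
    rw [add_mul, mul_assoc, hAG, mul_zero, one_mul, zero_add]
  have hdet : IsIdempotentElem G.det := by rw [IsIdempotentElem, ← Matrix.det_mul, hGG]
  have hf : f G.det = 1 := by
    rw [RingHom.map_det, hGr, map_add, map_mul, RingHom.mapMatrix_apply f A, hA]
    simp
  rcases hdet.eq_zero_or_eq_one_of_connectedSpace with h | h
  · rw [h, map_zero] at hf
    exact absurd hf zero_ne_one
  · have hu : IsUnit G := (Matrix.isUnit_iff_isUnit_det G).2 (by rw [h]; exact isUnit_one)
    rw [(IsIdempotentElem.iff_eq_one_of_isUnit hu).1 hGG, mul_one] at hAG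
    exact hAG

/-! ### Perfectness and eigenvalues in representations -/

theorem LieAlgebra.lie_top_top_of_isSemisimple (k L : Type*) [Field k] [LieRing L] [LieAlgebra k L]
    [LieAlgebra.IsSemisimple k L] : ⁅(⊤ : LieIdeal k L), (⊤ : LieIdeal k L)⁆ = ⊤ := by
  obtain ⟨I, hI⟩ := exists_isCompl ⁅(⊤ : LieIdeal k L), (⊤ : LieIdeal k L)⁆
  -- `⁅I, I⁆` lies both in `I` and in the derived ideal, which are complementary.
  have hab : IsLieAbelian I := by
    rw [LieSubmodule.lie_abelian_iff_lie_self_eq_bot, eq_bot_iff, ← hI.inf_eq_bot]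
    exact le_inf (LieSubmodule.mono_lie le_top le_top) (LieSubmodule.lie_le_right I I)
  have := (LieAlgebra.hasTrivialRadical_iff_no_abelian_ideals k L).1 inferInstance I hab
  simpa [this] using hI.sup_eq_top

theorem LieAlgebra.linearMap_eq_zero_of_isSemisimple {k L W : Type*} [Field k] [LieRing L]
    [LieAlgebra k L] [LieAlgebra.IsSemisimple k L] [AddCommGroup W] [Module k W] (f : L →ₗ[k] W)
    (hf : ∀ x y : L, f ⁅x, y⁆ = 0) : f = 0 := by
  ext x
  have hx : x ∈ ⁅(⊤ : LieIdeal k L), (⊤ : LieIdeal k L)⁆ := by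
    rw [LieAlgebra.lie_top_top_of_isSemisimple]; trivial
  rw [← LieSubmodule.mem_toSubmodule, LieSubmodule.lieIdeal_oper_eq_linear_span'] at hx
  have : Submodule.span k {⁅x, n⁆ | (x ∈ (⊤ : LieIdeal k L)) (n ∈ (⊤ : LieIdeal k L))} ≤ f.ker := by
    rw [Submodule.span_le]
    rintro _ ⟨a, -, b, -, rfl⟩
    exact hf a b
  exact this hx

theorem LieAlgebra.baseChange_linearMap_eq_zero_of_isSemisimple {k F L W : Type*} [Field k]
    [CommRing F] [Algebra k F] [LieRing L] [LieAlgebra k L] [LieAlgebra.IsSemisimple k L]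
    [AddCommGroup W] [Module F W] (f : F ⊗[k] L →ₗ[F] W)
    (hf : ∀ x y : F ⊗[k] L, f ⁅x, y⁆ = 0) : f = 0 := by
  let _ : Module k W := Module.compHom W (algebraMap k F)
  have : IsScalarTower k F W := IsScalarTower.of_algebraMap_smul fun _ _ => rfl
  have h := LieAlgebra.linearMap_eq_zero_of_isSemisimple
    (f.restrictScalars k ∘ₗ TensorProduct.mk k F L 1) fun x y => by
      have := hf (1 ⊗ₜ x) (1 ⊗ₜ y)
      simpa using this
  ext x
  simpa using congr($h x)

open Module.End in
/-- If `ad x` is diagonalizable with eigenvalues in the subfield `k` and the Lie algebra is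
perfect, then the eigenvalues of `x` in every finite-dimensional representation lie in `k`. -/
theorem LieModule.mem_range_algebraMap_of_hasEigenvalue_toEnd {k F G M : Type*} [Field k] [Field F]
    [CharZero F] [IsAlgClosed F] [Algebra k F] [LieRing G] [LieAlgebra F G] [AddCommGroup M]
    [Module F M] [LieRingModule G M] [LieModule F G M] [Module.Finite F M] (x : G)
    (hx : ⨆ μ : k, eigenspace (LieAlgebra.ad F G x) (algebraMap k F μ) = ⊤)
    (hG : ∀ f : G →ₗ[F] F, (∀ a b : G, f ⁅a, b⁆ = 0) → f = 0) (l : F)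
    (hl : HasEigenvalue (LieModule.toEnd F G M x) l) : l ∈ (algebraMap k F).range := by
  set T := LieModule.toEnd F G M x with hT
  let N₀ : Submodule F M := ⨆ μ : k, maxGenEigenspace T (l + algebraMap k F μ)
  -- An `ad x`-eigenvector of eigenvalue `ν` shifts generalized eigenvalues by `ν`.
  have hN (z : G) (m : M) (hm : m ∈ N₀) : ⁅z, m⁆ ∈ N₀ := by
    have hz : z ∈ ⨆ μ : k, eigenspace (LieAlgebra.ad F G x) (algebraMap k F μ) := hx ▸ trivial
    induction hz using Submodule.iSup_induction' with
    | zero => simp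
    | add a b _ _ ha hb => rw [add_lie]; exact add_mem ha hb
    | mem ν z hz =>
      induction hm using Submodule.iSup_induction' with
      | zero => simp
      | add a b _ _ ha hb => rw [lie_add]; exact add_mem ha hb
      | mem μ m hm =>
        refine Submodule.mem_iSup_of_mem (ν + μ) ?_
        have hz' : z ∈ maxGenEigenspace (LieModule.toEnd F G G x) (algebraMap k F ν) :=
          (genEigenspace _ _).mono le_top hz
        have := LieModule.lie_mem_maxGenEigenspace_toEnd hz' hm
        convert this using 2
        rw [map_add]; ring
  let N : LieSubmodule F G M := { N₀ with lie_mem := fun {z m} hm => hN z m hm }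
  have htr : LinearMap.trace F N (LieModule.toEnd F G N x) = 0 := by
    have := hG (LinearMap.trace F N ∘ₗ (LieModule.toEnd F G N : G →ₗ[F] Module.End F N))
      fun a b => by simp
    exact congr($this x)
  have hev (ν : F) (hν : HasEigenvalue (LieModule.toEnd F G N x) ν) :
      ν - l ∈ (algebraMap k F).range := by
    obtain ⟨v, hv⟩ := hν.exists_hasEigenvector
    by_contra hcon
    have hdis := T.independent_maxGenEigenspace ν
    have hvN : (v : M) ∈ ⨆ μ : k, maxGenEigenspace T (l + algebraMap k F μ) := v.2
    have hle : ⨆ μ : k, maxGenEigenspace T (l + algebraMap k F μ) ≤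
        ⨆ j, ⨆ (_ : j ≠ ν), maxGenEigenspace T j := by
      refine iSup_le fun μ => le_iSup₂_of_le (l + algebraMap k F μ) ?_ le_rfl
      rintro rfl
      exact hcon ⟨μ, by ring⟩
    have hvE : (v : M) ∈ maxGenEigenspace T ν := by
      refine (genEigenspace T ν).mono le_top (?_ : (v : M) ∈ eigenspace T ν)
      rw [mem_eigenspace_iff]
      exact congr(($(hv.apply_eq_smul) : M))
    have := Submodule.disjoint_def.1 hdis v hvE (hle hvN)
    exact hv.2 (Subtype.ext this)
  have hsum := trace_eq_sum_roots_charpoly_of_splits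
    (IsAlgClosed.splits (LieModule.toEnd F G N x).charpoly)
  -- Modulo `k`, the trace on `N` is `dim N` times `l`; since it vanishes, `l` is in `k` once `dim N
  -- ≠ 0`.
  have key (s : Multiset F) (hs : ∀ ν ∈ s, ν - l ∈ (algebraMap k F).range) :
      s.sum - s.card * l ∈ (algebraMap k F).range := by
    induction s using Multiset.induction_on with
    | empty => simp
    | cons a s ih =>
      have h1 := ih fun ν hν => hs ν (Multiset.mem_cons_of_mem hν)
      have h2 := add_mem (hs a (Multiset.mem_cons_self a s)) h1
      convert h2 using 1
      simp; ring
  have hk := key _ fun ν hν => hev ν <|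
    (hasEigenvalue_iff_isRoot_charpoly _ _).2 (Polynomial.isRoot_of_mem_roots hν)
  rw [← hsum, htr, zero_sub, neg_mem_iff] at hk
  have hcard : (LieModule.toEnd F G N x).charpoly.roots.card ≠ 0 := by
    rw [← (IsAlgClosed.splits (LieModule.toEnd F G N x).charpoly).natDegree_eq_card_roots,
      LinearMap.charpoly_natDegree]
    obtain ⟨v, hv⟩ := hl.exists_hasEigenvector
    have hvN : v ∈ N₀ := Submodule.mem_iSup_of_mem 0 <| by
      rw [map_zero, add_zero]
      exact (genEigenspace T l).mono le_top hv.1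
    have : Nontrivial N := ⟨⟨⟨v, hvN⟩, 0, fun h => hv.2 congr(($h : M))⟩⟩
    exact Module.finrank_pos.ne'
  obtain ⟨c, hc⟩ := hk
  have hcard' : ((LieModule.toEnd F G N x).charpoly.roots.card : F) ≠ 0 := Nat.cast_ne_zero.2 hcard
  refine ⟨c / ((LieModule.toEnd F G N x).charpoly.roots.card : k), ?_⟩
  rw [map_div₀, map_natCast, hc]
  field_simp

theorem LinearMap.trace_pow_mem_range_algebraMap {k F M : Type*} [Field k] [Field F]
    [IsAlgClosed F] [Algebra k F] [AddCommGroup M] [Module F M] [Module.Finite F M]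
    (T : Module.End F M) (hT : ∀ l, T.HasEigenvalue l → l ∈ (algebraMap k F).range) (m : ℕ) :
    LinearMap.trace F M (T ^ m) ∈ (algebraMap k F).range := by
  rcases m.eq_zero_or_pos with rfl | hm
  · rw [pow_zero, LinearMap.trace_one]
    exact natCast_mem _ _
  rw [Module.End.trace_eq_sum_roots_charpoly_of_splits (IsAlgClosed.splits _)]
  refine multiset_sum_mem _ fun ν hν => ?_
  have h := (Module.End.mem_spectrum_iff_isRoot_charpoly _ _).2 (Polynomial.isRoot_of_mem_roots hν)
  rw [spectrum.map_pow_of_pos _ hm] at h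
  obtain ⟨l, hl, rfl⟩ := h
  exact pow_mem (hT l (Module.End.hasEigenvalue_iff_mem_spectrum.2 hl)) m

/-! ### Base change of the representation and of diagonalizability -/

theorem toMatrix_baseChangeRep_tmul {k A L V ι : Type*} [Field k] [CommRing A] [Algebra k A]
    [LieRing L] [LieAlgebra k L] [AddCommGroup V] [Module k V] [LieRingModule L V]
    [LieModule k L V] [Fintype ι] [DecidableEq ι] (b : Module.Basis ι k V) (a : A) (l : L) :
    LinearMap.toMatrix (Algebra.TensorProduct.basis A b) (Algebra.TensorProduct.basis A b)
      (baseChangeRep k V (a ⊗ₜ[k] l)) =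
        a • (LinearMap.toMatrix b b (LieModule.toEnd k L V l)).map (algebraMap k A) := by
  rw [baseChangeRep, ← mul_one a, ← smul_eq_mul, ← TensorProduct.smul_tmul', map_smul, map_smul,
    LieModule.toEnd_baseChange, LinearMap.toMatrix_baseChange, smul_eq_mul, mul_one]

theorem toMatrix_baseChangeRep_map {k R F L V ι : Type*} [Field k] [CommRing R] [Algebra k R]
    [CommRing F] [Algebra k F] [Algebra R F] [IsScalarTower k R F] [LieRing L] [LieAlgebra k L]
    [AddCommGroup V] [Module k V] [LieRingModule L V] [LieModule k L V] [Fintype ι] [DecidableEq ι]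
    (b : Module.Basis ι k V) (p : R ⊗[k] L) :
    LinearMap.toMatrix (Algebra.TensorProduct.basis F b) (Algebra.TensorProduct.basis F b) (baseChangeRep k V
      (LieAlgebra.ExtendScalars.map (IsScalarTower.toAlgHom k R F) (LieHom.id : L →ₗ⁅k⁆ L) p)) =
    (LinearMap.toMatrix (Algebra.TensorProduct.basis R b) (Algebra.TensorProduct.basis R b) (baseChangeRep k V p)).map
      (algebraMap R F) := by
  induction p with
  | zero => simp [baseChangeRep]
  | add x y hx hy =>
    rw [baseChangeRep] at hx hy ⊢
    rw [map_add, map_add, map_add, hx, hy, baseChangeRep, baseChangeRep, baseChangeRep, map_add,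
      map_add, Matrix.map_add _ (map_add _)]
  | tmul a l =>
    rw [LieAlgebra.ExtendScalars.map_apply_tmul]
    refine (toMatrix_baseChangeRep_tmul _ _ _).trans ?_
    rw [toMatrix_baseChangeRep_tmul]
    ext i j
    simp [IsScalarTower.algebraMap_apply k R F]

theorem algebraMap_trace_baseChangeRep_pow {k R F L V : Type*} [Field k] [CommRing R] [Algebra k R]
    [CommRing F] [Algebra k F] [Algebra R F] [IsScalarTower k R F] [LieRing L] [LieAlgebra k L]
    [AddCommGroup V] [Module k V] [Module.Finite k V] [LieRingModule L V] [LieModule k L V]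
    (p : R ⊗[k] L) (m : ℕ) :
    algebraMap R F (LinearMap.trace R (R ⊗[k] V) (baseChangeRep k V p ^ m)) =
      LinearMap.trace F (F ⊗[k] V) (baseChangeRep k V (LieAlgebra.ExtendScalars.map
        (IsScalarTower.toAlgHom k R F) (LieHom.id : L →ₗ⁅k⁆ L) p) ^ m) := by
  classical
  let b := Module.finBasis k V
  rw [LinearMap.trace_eq_matrix_trace R (Algebra.TensorProduct.basis R b),
    LinearMap.trace_eq_matrix_trace F (Algebra.TensorProduct.basis F b), ← LinearMap.toMatrix_pow,
    ← LinearMap.toMatrix_pow, toMatrix_baseChangeRep_map, AddMonoidHom.map_trace]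
  congr 1
  exact map_pow (algebraMap R F).mapMatrix _ m

theorem IsKDiagonalizable.iSup_eigenspace_map_eq_top {k R F L : Type*} [Field k] [CommRing R]
    [Algebra k R] [CommRing F] [Algebra k F] [Algebra R F] [IsScalarTower k R F] [LieRing L]
    [LieAlgebra k L] {p : R ⊗[k] L} (hp : IsKDiagonalizable k p) :
    ⨆ μ : k, Module.End.eigenspace (LieAlgebra.ad F (F ⊗[k] L) (LieAlgebra.ExtendScalars.map
      (IsScalarTower.toAlgHom k R F) (LieHom.id : L →ₗ⁅k⁆ L) p)) (algebraMap k F μ) = ⊤ := by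
  set φ := LieAlgebra.ExtendScalars.map (IsScalarTower.toAlgHom k R F) (LieHom.id : L →ₗ⁅k⁆ L)
  set N := ⨆ μ : k, Module.End.eigenspace (LieAlgebra.ad F (F ⊗[k] L) (φ p)) (algebraMap k F μ)
  have h : (⊤ : Submodule k (R ⊗[k] L)) ≤ (N.restrictScalars k).comap (φ : R ⊗[k] L →ₗ[k] _) := by
    rw [← hp]
    refine iSup_le fun μ z hz => ?_
    rw [Module.End.mem_eigenspace_iff] at hz
    refine Submodule.mem_iSup_of_mem μ ?_
    rw [Module.End.mem_eigenspace_iff]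
    have := congr(φ $hz)
    rw [LieAlgebra.ad_apply, LieHom.map_lie, map_smul] at this
    rw [algebraMap_smul]
    exact this
  rw [eq_top_iff]
  rintro z -
  induction z with
  | zero => exact zero_mem _
  | add x y hx hy => exact add_mem hx hy
  | tmul a l =>
    have h1 : φ (1 ⊗ₜ l) ∈ N := h trivial
    have h2 : φ (1 ⊗ₜ[k] l) = 1 ⊗ₜ l := by simp [φ]
    rw [h2] at h1
    simpa [TensorProduct.smul_tmul'] using N.smul_mem a h1

theorem IsKDiagonalizable.trace_pow_mem_range {k R L V : Type*} [Field k] [CharZero k]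
    [LieRing L] [LieAlgebra k L] [LieAlgebra.IsSemisimple k L] [CommRing R] [Algebra k R]
    [ConnectedSpace (PrimeSpectrum R)] [IsReduced R] [AddCommGroup V] [Module k V]
    [Module.Finite k V] [LieRingModule L V] [LieModule k L V] {p : R ⊗[k] L}
    (hp : IsKDiagonalizable k p) (m : ℕ) :
    LinearMap.trace R (R ⊗[k] V) (baseChangeRep k V p ^ m) ∈ Set.range (algebraMap k R) := by
  refine mem_range_algebraMap_of_forall_prime _ fun P hP => ?_
  let F := AlgebraicClosure P.ResidueField
  have : CharZero F := charZero_of_injective_algebraMap (algebraMap k F).injective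
  obtain ⟨c, hc⟩ := LinearMap.trace_pow_mem_range_algebraMap (k := k) (F := F) _
    (LieModule.mem_range_algebraMap_of_hasEigenvalue_toEnd (M := F ⊗[k] V) _
      (hp.iSup_eigenspace_map_eq_top (F := F))
      (fun f => LieAlgebra.baseChange_linearMap_eq_zero_of_isSemisimple f)) m
  refine ⟨c, ?_⟩
  rw [← Ideal.algebraMap_residueField_eq_zero (I := P)]
  apply (algebraMap P.ResidueField F).injective
  rw [← IsScalarTower.algebraMap_apply, map_zero, map_sub, algebraMap_trace_baseChangeRep_pow,
    ← IsScalarTower.algebraMap_apply, hc, sub_eq_zero]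
  rfl

-- Vanishing at a point

attribute [local instance] LieRing.ofAssociativeRing in
-- A `k`-basis of `R` splits `R ⊗ L` into copies of `L`, compatibly with brackets by `1 ⊗ x`, so
-- each coordinate of `p` is central in `L`.
theorem LieAlgebra.eq_zero_of_ad_baseChange_eq_zero {k R L : Type*} [Field k] [CommRing R]
    [Algebra k R] [LieRing L] [LieAlgebra k L] [LieAlgebra.HasTrivialRadical k L] (p : R ⊗[k] L)
    (hp : LieAlgebra.ad R (R ⊗[k] L) p = 0) : p = 0 := by
  let b := Module.Free.chooseBasis k R
  let e := TensorProduct.equivFinsuppOfBasisLeft (M := R) (N := L) b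
  have he (x : L) (z : R ⊗[k] L) (i) : e ⁅z, (1 : R) ⊗ₜ[k] x⁆ i = ⁅e z i, x⁆ := by
    induction z with
    | zero => simp
    | add x y hx hy => simp [hx, hy]
    | tmul a l => simp [e]
  refine e.injective (Finsupp.ext fun i => ?_)
  rw [map_zero, Finsupp.zero_apply]
  have hker : e p i ∈ (LieAlgebra.ad k L).ker := by
    rw [LieHom.mem_ker]
    ext x
    have := congr($hp (1 ⊗ₜ x))
    rw [LieAlgebra.ad_apply, LinearMap.zero_apply] at this
    rw [LieAlgebra.ad_apply, ← he, this]
    simp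
  rwa [LieAlgebra.ad_ker_eq_bot_of_hasTrivialRadical, LieSubmodule.mem_bot] at hker

theorem IsKDiagonalizable.exists_aeval_eq_zero {k R L : Type*} [Field k] [CommRing R]
    [Algebra k R] [LieRing L] [LieAlgebra k L] [Module.Finite k L] {p : R ⊗[k] L}
    (hp : IsKDiagonalizable k p) :
    ∃ q : Polynomial R, q.eval 0 = 1 ∧
      Polynomial.aeval (LieAlgebra.ad R (R ⊗[k] L) p) (Polynomial.X * q) = 0 := by
  classical
  set T := LieAlgebra.ad R (R ⊗[k] L) p
  let b := Module.finBasis k L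
  have hs (v : R ⊗[k] L) : ∃ s : Finset k,
      v ∈ ⨆ μ ∈ s, Module.End.eigenspace (LieAlgebra.ad k (R ⊗[k] L) p) μ := by
    have hv : v ∈ ⨆ μ : k, Module.End.eigenspace (LieAlgebra.ad k (R ⊗[k] L) p) μ := by
      rw [show _ = ⊤ from hp]; trivial
    exact (Submodule.mem_iSup_iff_exists_finset).1 hv
  choose s hs using hs
  -- Finitely many eigenvalues suffice: `ad p` is `R`-linear and the `1 ⊗ b i` generate over `R`.
  let S : Finset k := Finset.univ.biUnion fun i => s (1 ⊗ₜ b i)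
  -- The factors `1 - ν⁻¹ X` have root `ν` and are normalized to give `q(0) = 1`.
  let q : Polynomial R :=
    ∏ ν ∈ S.erase 0, (1 - Polynomial.C (algebraMap k R ν⁻¹) * Polynomial.X)
  refine ⟨q, by simp [q, Polynomial.eval_prod], ?_⟩
  have heig (μ : k) (v : R ⊗[k] L) (hv : T v = algebraMap k R μ • v) (f : Polynomial R) :
      Polynomial.aeval T f v = f.eval (algebraMap k R μ) • v := by
    by_cases h0 : v = 0
    · simp [h0]
    · exact Module.End.aeval_apply_of_hasEigenvector ⟨Module.End.mem_eigenspace_iff.2 hv, h0⟩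
  refine (Algebra.TensorProduct.basis R b).ext fun i => ?_
  rw [LinearMap.zero_apply, Algebra.TensorProduct.basis_apply]
  have hle : ⨆ μ ∈ s (1 ⊗ₜ b i), Module.End.eigenspace (LieAlgebra.ad k (R ⊗[k] L) p) μ ≤
      ((Polynomial.aeval T (Polynomial.X * q)).restrictScalars k).ker := by
    refine iSup₂_le fun μ hμ v hv => ?_
    rw [Module.End.mem_eigenspace_iff] at hv
    rw [LinearMap.mem_ker, LinearMap.restrictScalars_apply, heig μ v (by
      rw [algebraMap_smul]; exact hv)]
    suffices h : (Polynomial.X * q).eval (algebraMap k R μ) = 0 by rw [h, zero_smul]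
    by_cases h0 : μ = 0
    · simp [h0]
    have hμS : μ ∈ S.erase 0 := Finset.mem_erase.2 ⟨h0, Finset.mem_biUnion.2 ⟨i, by simp, hμ⟩⟩
    rw [Polynomial.eval_mul, Polynomial.eval_prod, Finset.prod_eq_zero hμS, mul_zero]
    simp [← map_mul, h0]
  exact hle (hs _)

theorem IsKDiagonalizable.eq_zero_of_evalAtPoint_eq_zero {k R L : Type*} [Field k]
    [LieRing L] [LieAlgebra k L] [Module.Finite k L] [LieAlgebra.HasTrivialRadical k L] [CommRing R]
    [Algebra k R] [ConnectedSpace (PrimeSpectrum R)] {p : R ⊗[k] L}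
    (hp : IsKDiagonalizable k p) (y : PrimeSpectrum R) (hy : evalAtPoint k y p = 0) : p = 0 := by
  classical
  let b := Module.finBasis k L
  obtain ⟨q, hq, hpq⟩ := hp.exists_aeval_eq_zero
  refine LieAlgebra.eq_zero_of_ad_baseChange_eq_zero p ?_
  -- With `V = L` the adjoint representation, `baseChangeRep` is `ad p`.
  have hA := toMatrix_baseChangeRep_map (F := y.asIdeal.ResidueField) b p
  rw [show LieAlgebra.ExtendScalars.map _ _ p = 0 from hy, baseChangeRep, map_zero, map_zero] at hA
  have h := Matrix.eq_zero_of_aeval_X_mul_eq_zero _ _ hA.symm q hq (by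
    have := congr(LinearMap.toMatrixAlgEquiv (Algebra.TensorProduct.basis R b) $hpq)
    rw [← AlgEquiv.coe_toAlgHom, ← Polynomial.aeval_algHom_apply, map_zero] at this
    exact this)
  exact (LinearMap.toMatrix (Algebra.TensorProduct.basis R b) (Algebra.TensorProduct.basis R b)).map_eq_zero_iff.1 h

theorem proposition6 {k R L V : Type*} [Field k] [CharZero k]
    [LieRing L] [LieAlgebra k L] [Module.Finite k L] [LieAlgebra.IsSemisimple k L]
    (hsplit : LieIsSplit k L)
    [CommRing R] [Algebra k R] [ConnectedSpace (PrimeSpectrum R)] [IsReduced R]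
    [AddCommGroup V] [Module k V] [Module.Finite k V] [LieRingModule L V] [LieModule k L V]
    (p : R ⊗[k] L) (hp : IsKDiagonalizable k p) :
    (∀ m : ℕ, LinearMap.trace R (R ⊗[k] V) (baseChangeRep k V p ^ m) ∈
        Set.range (algebraMap k R)) ∧
      ((∃ y : PrimeSpectrum R, evalAtPoint k y p = 0) → p = 0) :=
  ⟨hp.trace_pow_mem_range, fun ⟨y, hy⟩ => hp.eq_zero_of_evalAtPoint_eq_zero y hy⟩
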